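/- There is an absolute constant $K>0$ such that the following holds. Let $G=(V,E)$ be a finite simple graph with $n=|V|$, let $\varepsilon\in(0,1/4)$, $c\ge \frac1{1-\varepsilon}$, $d\ge \frac{4\log(2/\varepsilon)}{\varepsilon^2}$ (natural logarithm), and let $\gamma\ge 1$ be an integer. A fractional matching is a vector $x\in\mathbb R_{\ge 0}^E$ with $\sum_{e\ni v}x_e\le 1$ for all $v\in V$. It is $(c,d)$-approximately-maximal if every $e\in E$ has $x_e>1/d$ or has an endpoint $v$ with $\sum_{e'\ni v}x_{e'}\ge 1/c$ and $x_{e'}\le 1/d$ for all $e'\ni v$. The algorithm, run on $x$ with parameters $\varepsilon,d,\gamma$: for each $i=1,\dots,\lceil 2\log_{1+\varepsilon}(n/\varepsilon)\rceil$ let $G_i$ be the subgraph of $G$ with edge set $E_i=\{e\in E: x_e\in((1+\varepsilon)^{-i},(1+\varepsilon)^{-i+1}]\}$, take any proper edge coloring of $G_i$ with $\gamma\lceil(1+\varepsilon)^i\rceil$ colors, and sample, uniformly without replacement and independently for different $i$, $\min\{\gamma\lceil d(1+\varepsilon)\rceil,\gamma\lceil(1+\varepsilon)^i\rceil\}$ of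 these colors. The output $H$ is the graph on $V$ whose edges are all edges of sampled colors. A random subgraph $\mathcal H$ of $G$ is a $(c',d',\varepsilon)$-kernel of $G$ if always $d_{\mathcal H}(v)\le d'$ for all $v\in V$, and for every $e\in E$ with $\Pr[e\notin\mathcal H]>\varepsilon$ one has $\mathbb E[\max_{v\in e}d_{\mathcal H}(v)\mid e\notin\mathcal H]\ge d'/c'$. Let $x$ be a $(c,d)$-approximately-maximal fractional matching. Assume that $c\le\varepsilon d$ and $c\le n/\varepsilon$ (both hold automatically if $c\le 1/\varepsilon$ and $n\ge1$), and that every edge $e$ with $x_e>1/d$ lies in some $E_i$ (automatic if $d\le (n/\varepsilon)^2$). Let $H$ be the random output of the algorithm on $x$, for any choice of the colorings, and let $H'$ be obtained from $H$ by removing all edges at vertices $v$ with $d_H(v)>d(1+4\varepsilon)$. Then the distribution of $H'$ is a $\bigl(c(1+K\varepsilon),\,d(1+4\varepsilon),\,\varepsilon\bigr)$-kernel of $G$. -/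

import Mathlib

open MeasureTheory ProbabilityTheory

noncomputable section

namespace EdgeColorSparsify

variable {V : Type*} [Fintype V]

open Classical in
/-- A fractional matching of `G`: nonnegative edge values whose sum at every vertex is at most `1`.
Values of `x` off the edges of `G` are never used. -/
structure IsFractionalMatching (G : SimpleGraph V) (x : Sym2 V → ℝ) : Prop where
  nonneg : ∀ e ∈ G.edgeSet, 0 ≤ x e
  sum_le_one : ∀ v : V, ∑ e ∈ G.incidenceFinset v, x e ≤ 1

open Classical in
/-- A `(c,d)`-approximately-maximal fractional matching of `G`. -/
structure IsApproxMaximal (G : SimpleGraph V) (x : Sym2 V → ℝ) (c d : ℝ) : Prop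
    extends IsFractionalMatching G x where
  covered : ∀ e ∈ G.edgeSet, 1 / d < x e ∨
    ∃ v ∈ e, 1 / c ≤ ∑ e' ∈ G.incidenceFinset v, x e' ∧
      ∀ e' ∈ G.incidenceFinset v, x e' ≤ 1 / d

/-! ### The algorithm -/

/-- The number `⌈2 log_{1+ε}(n/ε)⌉` of value ranges. -/
def numLevels (n : ℕ) (ε : ℝ) : ℕ := ⌈2 * Real.logb (1 + ε) ((n : ℝ) / ε)⌉₊

/-- The index set `{1, …, ⌈2 log_{1+ε}(n/ε)⌉}` of the value ranges. -/
abbrev Level (n : ℕ) (ε : ℝ) : Type := ↥(Finset.Icc 1 (numLevels n ε))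

/-- The graph `G_i`, with edges those `e` of `G` with `x_e ∈ ((1+ε)^{-i}, (1+ε)^{-i+1}]`. -/
def levelGraph (G : SimpleGraph V) (x : Sym2 V → ℝ) (ε : ℝ) (i : ℕ) : SimpleGraph V :=
  SimpleGraph.fromEdgeSet
    {e | e ∈ G.edgeSet ∧ x e ∈ Set.Ioc ((1 + ε) ^ (-(i : ℤ))) ((1 + ε) ^ (-(i : ℤ) + 1))}

/-- The palette size `γ ⌈(1+ε)^i⌉` used on `G_i`. -/
def numColors (γ : ℕ) (ε : ℝ) (i : ℕ) : ℕ := γ * ⌈(1 + ε) ^ i⌉₊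

/-- The number `min {γ ⌈d(1+ε)⌉, γ ⌈(1+ε)^i⌉}` of colors sampled in `G_i`. -/
def numSampled (γ : ℕ) (ε d : ℝ) (i : ℕ) : ℕ :=
  min (γ * ⌈d * (1 + ε)⌉₊) (numColors γ ε i)

/-- A choice, for every `i`, of a proper edge coloring of `G_i` with `γ ⌈(1+ε)^i⌉` colors. -/
abbrev LevelColorings (G : SimpleGraph V) (x : Sym2 V → ℝ) (ε : ℝ) (γ : ℕ) : Type _ :=
  ∀ i : Level (Fintype.card V) ε,
    (levelGraph G x ε i).lineGraph.Coloring (Fin (numColors γ ε i))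

/-- The possible samples: for every `i`, a set of exactly `numSampled γ ε d i` colors. -/
def samples (n γ : ℕ) (ε d : ℝ) :
    Finset (∀ i : Level n ε, Finset (Fin (numColors γ ε i))) :=
  Fintype.piFinset fun i => Finset.powersetCard (numSampled γ ε d i) Finset.univ

theorem samples_nonempty (n γ : ℕ) (ε d : ℝ) : (samples n γ ε d).Nonempty := by
  refine Fintype.piFinset_nonempty.2 fun i => Finset.powersetCard_nonempty.2 ?_
  simp [numSampled]

/-- The union of the sampled color classes. -/
def sampledGraph {G : SimpleGraph V} {x : Sym2 V → ℝ} {ε : ℝ} {γ : ℕ}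
    (χ : LevelColorings G x ε γ)
    (S : ∀ i : Level (Fintype.card V) ε, Finset (Fin (numColors γ ε i))) : SimpleGraph V :=
  SimpleGraph.fromEdgeSet
    {e | ∃ i : Level (Fintype.card V) ε, ∃ h : e ∈ (levelGraph G x ε i).edgeSet, χ i ⟨e, h⟩ ∈ S i}

/-- The distribution of the output graph. In every `G_i` the set of sampled colors is a uniform
sample without replacement, and the samples for different `i` are independent: jointly, they are
uniform on the product set `samples`. -/
def outputDist {G : SimpleGraph V} {x : Sym2 V → ℝ} {ε : ℝ} {γ : ℕ}
    (χ : LevelColorings G x ε γ) (d : ℝ) : PMF (SimpleGraph V) :=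
  (PMF.uniformOfFinset (samples (Fintype.card V) γ ε d)
    (samples_nonempty (Fintype.card V) γ ε d)).map (sampledGraph χ)

open Classical in
/-- Remove from `H` all edges at vertices of `H`-degree greater than `D`. -/
def trim (H : SimpleGraph V) (D : ℝ) : SimpleGraph V where
  Adj u v := H.Adj u v ∧ (H.degree u : ℝ) ≤ D ∧ (H.degree v : ℝ) ≤ D
  symm := ⟨fun _ _ h => ⟨h.1.symm, h.2.2, h.2.1⟩⟩
  loopless := ⟨fun v h => H.loopless.irrefl v h.1⟩

/-! ### Kernels -/

open Classical in
/-- `max_{v ∈ e} d_H(v)`. -/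
def maxDegree (H : SimpleGraph V) (e : Sym2 V) : ℕ := e.toFinset.sup fun v => H.degree v

open Classical in
/-- The random graph with distribution `𝓗` is a `(c,d,ε)`-kernel of `G`. -/
structure IsKernel (G : SimpleGraph V) (𝓗 : PMF (SimpleGraph V)) (c d ε : ℝ) : Prop where
  le : ∀ H ∈ 𝓗.support, H ≤ G
  degree_le : ∀ H ∈ 𝓗.support, ∀ v : V, (H.degree v : ℝ) ≤ d
  le_condExp : ∀ e ∈ G.edgeSet, ε < 𝓗.toMeasure.real {H | e ∉ H.edgeSet} →
    d / c ≤ ∫ H, (maxDegree H e : ℝ) ∂(𝓗.toMeasure[|{H | e ∉ H.edgeSet}])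

end EdgeColorSparsify

end

/-! Write `r_e` for the probability that `e` is sampled (`edgeRate`) and `t = (1+ε)(ε/2)^4`. Edges
of one level meeting at a vertex have distinct colors, and sampling without replacement,
independently across levels, is negatively correlated: a set `T` of edges at one vertex satisfies
`P[T ⊆ H] ≤ ∏ r_e` (`expect_subset_sampledGraph_le`).

These bounds give an upper Chernoff tail. Keeping one edge `f` as a factor yields `P[f ∈ H, d_H(w) >
d(1+4ε)] ≤ t r_f` (`expect_mem_and_lt_degree_le`). Being proportional to `r_f`, the bound shows that
trimming costs only a fraction `2t` of the expected degree. No lower tail is needed.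

The rates are close to `d x_e` when `x_e ≤ 1/d`, up to a loss for tiny `x_e`, and equal `1` when
`x_e > 1/d`. An edge absent from `H'` with probability above `ε` therefore has an endpoint `v` with
`∑ x ≥ 1/c` and all values at most `1/d`, so its expected degree in `H` is at least `(1-ε)² d/c`
(`le_sum_edgeRate`). Pairwise negative correlation bounds `E[d_{H'}(v); e ∉ H']` below by `∑_{f≠e}
r_f (1 - r_e - 2t)` (`le_expect_maxDegree`). Dividing by `P[e ∉ H'] ≤ 1 - r_e + 2t` costs a factor
`1-ε`, since this probability exceeds `ε` while `4t ≤ ε²`. -/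

section

open Classical Finset
open scoped BigOperators

namespace EdgeColorSparsify

/-! ### Negatively correlated random sets -/

section RandomSet

variable {Ω E : Type*} [DecidableEq E]

/-- The moment generating function expands with nonnegative coefficients in the indicators of `T ⊆
X`, so upper bounds on these joint probabilities suffice. The event `a ∈ X` is carried through to
extract the factor `p a`. -/
theorem expect_mem_mul_one_add_pow_le (s : Finset Ω) (X : Ω → Finset E) (M : Finset E) (p : E → ℝ)
    (hp : ∀ e, 0 ≤ p e)
    (hX : ∀ T ⊆ M, 𝔼 ω ∈ s, (if T ⊆ X ω then (1 : ℝ) else 0) ≤ ∏ e ∈ T, p e)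
    {y : ℝ} (hy : 0 ≤ y) {a : E} (ha : a ∈ M) :
    𝔼 ω ∈ s, (if a ∈ X ω then (1 + y) ^ #(X ω ∩ M) else 0) ≤
      (1 + y) * p a * Real.exp (y * ∑ e ∈ M, p e) := by
  -- The element `a` contributes one factor `1 + y`; the binomial theorem expands the rest over
  -- subsets of `M` avoiding `a`.
  have key : ∀ ω, (if a ∈ X ω then (1 + y) ^ #(X ω ∩ M) else 0) =
      ∑ T ∈ (M.erase a).powerset,
        (1 + y) * y ^ #T * (if insert a T ⊆ X ω then (1 : ℝ) else 0) := by
    intro ω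
    split_ifs with h
    · have h1 : X ω ∩ M = insert a (X ω ∩ M.erase a) := by
        ext e; simp only [mem_inter, mem_insert, mem_erase]
        by_cases he : e = a
        · subst he; simp [h, ha]
        · simp [he]
      have h2 : (1 + y) ^ #(X ω ∩ M.erase a) = ∑ T ∈ (X ω ∩ M.erase a).powerset, y ^ #T := by
        rw [add_comm, ← Finset.sum_pow_mul_eq_add_pow]; simp
      rw [h1, card_insert_of_notMem (by simp), pow_succ', h2, mul_sum]
      have h3 : (X ω ∩ M.erase a).powerset =
          (M.erase a).powerset.filter (fun T => insert a T ⊆ X ω) := by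
        ext T; simp only [mem_powerset, mem_filter, subset_inter_iff, insert_subset_iff, h,
          true_and, and_comm]
      rw [h3, sum_filter]
      exact sum_congr rfl fun T _ => by split_ifs <;> simp
    · symm
      refine sum_eq_zero fun T _ => ?_
      rw [if_neg fun h' => h (h' (mem_insert_self _ _)), mul_zero]
  simp_rw [key]
  rw [expect_sum_comm]
  calc ∑ T ∈ (M.erase a).powerset, 𝔼 ω ∈ s,
        (1 + y) * y ^ #T * (if insert a T ⊆ X ω then (1 : ℝ) else 0)
      ≤ ∑ T ∈ (M.erase a).powerset, (1 + y) * p a * ∏ e ∈ T, (y * p e) := by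
        refine sum_le_sum fun T hT => ?_
        have hT' := mem_powerset.1 hT
        have haT : a ∉ T := fun h => by simpa using hT' h
        rw [← mul_expect]
        calc _ ≤ (1 + y) * y ^ #T * ∏ e ∈ insert a T, p e := by
              refine mul_le_mul_of_nonneg_left (hX _ ?_) (by positivity)
              exact insert_subset ha (hT'.trans (erase_subset _ _))
          _ = _ := by
              rw [prod_insert haT, prod_mul_distrib, prod_const]; ring
    _ = (1 + y) * p a * ∏ e ∈ M.erase a, (1 + y * p e) := by rw [← mul_sum, prod_one_add]
    _ ≤ (1 + y) * p a * Real.exp (y * ∑ e ∈ M, p e) := by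
        refine mul_le_mul_of_nonneg_left ?_ (mul_nonneg (by positivity) (hp a))
        refine (prod_le_prod (fun e _ => add_nonneg zero_le_one (mul_nonneg hy (hp e)))
          fun e _ => (add_comm 1 (y * p e)).le.trans (Real.add_one_le_exp _)).trans ?_
        rw [← Real.exp_sum, Real.exp_le_exp, mul_sum]
        exact sum_le_sum_of_subset_of_nonneg (erase_subset _ _)
          fun e _ _ => mul_nonneg hy (hp e)

/-- Markov's inequality for `(1 + y) ^ #(X ∩ M)`, restricted to the event `a ∈ X`. -/
theorem expect_mem_and_lt_card_le (s : Finset Ω) (X : Ω → Finset E) (M : Finset E) (p : E → ℝ)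
    (hp : ∀ e, 0 ≤ p e)
    (hX : ∀ T ⊆ M, 𝔼 ω ∈ s, (if T ⊆ X ω then (1 : ℝ) else 0) ≤ ∏ e ∈ T, p e)
    {y : ℝ} (hy : 0 ≤ y) (D : ℝ) {a : E} (ha : a ∈ M) :
    𝔼 ω ∈ s, (if a ∈ X ω ∧ D < #(X ω ∩ M) then (1 : ℝ) else 0) ≤
      (1 + y) * Real.exp (y * (∑ e ∈ M, p e) - D * Real.log (1 + y)) * p a := by
  have hy1 : 0 < 1 + y := by positivity
  calc 𝔼 ω ∈ s, (if a ∈ X ω ∧ D < #(X ω ∩ M) then (1 : ℝ) else 0)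
      ≤ 𝔼 ω ∈ s, Real.exp (-(D * Real.log (1 + y))) *
          (if a ∈ X ω then (1 + y) ^ #(X ω ∩ M) else 0) := by
        refine expect_le_expect fun ω _ => ?_
        by_cases h : a ∈ X ω
        · rw [if_pos h]
          by_cases h' : D < #(X ω ∩ M)
          · rw [if_pos ⟨h, h'⟩, ← Real.exp_log (pow_pos hy1 #(X ω ∩ M)), Real.log_pow,
              ← Real.exp_add]
            refine Real.one_le_exp ?_
            have := mul_le_mul_of_nonneg_right h'.le (Real.log_nonneg (by linarith : 1 ≤ 1 + y))
            linarith
          · rw [if_neg (fun h'' => h' h''.2)]; positivity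
        · simp [h]
    _ ≤ Real.exp (-(D * Real.log (1 + y))) *
          ((1 + y) * p a * Real.exp (y * ∑ e ∈ M, p e)) := by
        rw [← mul_expect]
        exact mul_le_mul_of_nonneg_left (expect_mem_mul_one_add_pow_le s X M p hp hX hy ha)
          (Real.exp_nonneg _)
    _ = _ := by rw [sub_eq_add_neg, Real.exp_add]; ring

end RandomSet

/-! ### Uniform subsets of fixed size -/

/-- Each further prescribed element multiplies the count by `(k-j)/(N-j) ≤ k/N`; this is the
negative correlation of sampling without replacement. -/
theorem choose_sub_le_pow_mul_choose {N k : ℕ} (hk : k ≤ N) (j : ℕ) (hj : j ≤ k) :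
    ((N - j).choose (k - j) : ℝ) ≤ ((k : ℝ) / N) ^ j * N.choose k := by
  induction j with
  | zero => simp
  | succ j ih =>
    have ih := ih (by omega)
    obtain ⟨m, hm⟩ : ∃ m, N - j = m + 1 := ⟨N - j - 1, by omega⟩
    obtain ⟨l, hl⟩ : ∃ l, k - j = l + 1 := ⟨k - j - 1, by omega⟩
    have h1 : N - (j + 1) = m := by omega
    have h2 : k - (j + 1) = l := by omega
    have hN : (0 : ℝ) < N := by exact_mod_cast (by omega : 0 < N)
    rw [h1, h2]
    rw [hm, hl] at ih
    have h3 : ((m : ℝ) + 1) * (m.choose l : ℝ) = ((m + 1).choose (l + 1) : ℝ) * (l + 1) := by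
      exact_mod_cast Nat.add_one_mul_choose_eq m l
    have h4 : ((l : ℝ) + 1) / (m + 1) ≤ k / N := by
      rw [div_le_div_iff₀ (by positivity) hN]
      have e1 : (N : ℝ) = m + 1 + j := by exact_mod_cast (by omega : N = m + 1 + j)
      have e2 : (k : ℝ) = l + 1 + j := by exact_mod_cast (by omega : k = l + 1 + j)
      have e3 : (l : ℝ) ≤ m := by exact_mod_cast (by omega : l ≤ m)
      rw [e1, e2]
      nlinarith [mul_le_mul_of_nonneg_right e3 (Nat.cast_nonneg (α := ℝ) j)]
    calc (m.choose l : ℝ) = ((l : ℝ) + 1) / (m + 1) * ((m + 1).choose (l + 1) : ℝ) := by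
          field_simp; linarith
      _ ≤ (k / N) * (((k : ℝ) / N) ^ j * N.choose k) :=
          mul_le_mul h4 ih (by positivity) (by positivity)
      _ = _ := by ring

theorem expect_subset_powersetCard {N k : ℕ} (C : Finset (Fin N)) (hC : #C ≤ k) :
    𝔼 S ∈ powersetCard k (univ : Finset (Fin N)), (if C ⊆ S then (1 : ℝ) else 0) =
      ((N - #C).choose (k - #C) : ℝ) / N.choose k := by
  rw [expect_eq_sum_div_card, sum_boole, card_powersetCard, card_univ, Fintype.card_fin,
    card_filter_powersetCard_subset _ _ _ (subset_univ _) hC, card_univ, Fintype.card_fin]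

theorem expect_subset_powersetCard_le {N k : ℕ} (hk : k ≤ N) (C : Finset (Fin N)) :
    𝔼 S ∈ powersetCard k (univ : Finset (Fin N)), (if C ⊆ S then (1 : ℝ) else 0) ≤
      ((k : ℝ) / N) ^ #C := by
  by_cases hC : #C ≤ k
  · rw [expect_subset_powersetCard C hC, div_le_iff₀ (by exact_mod_cast Nat.choose_pos hk)]
    exact choose_sub_le_pow_mul_choose hk _ hC
  · rw [expect_eq_zero]
    · positivity
    · intro S hS
      rw [if_neg]
      intro h
      exact hC ((card_le_card h).trans (mem_powersetCard.1 hS).2.le)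

theorem expect_mem_powersetCard {N k : ℕ} (hk : k ≤ N) (a : Fin N) :
    𝔼 S ∈ powersetCard k (univ : Finset (Fin N)), (if {a} ⊆ S then (1 : ℝ) else 0) =
      (k : ℝ) / N := by
  rcases Nat.eq_zero_or_pos k with rfl | hk0
  · simp
  · rw [expect_subset_powersetCard {a} (by rw [card_singleton]; exact hk0), card_singleton]
    obtain ⟨l, rfl⟩ : ∃ l, k = l + 1 := ⟨k - 1, by omega⟩
    obtain ⟨m, rfl⟩ : ∃ m, N = m + 1 := ⟨N - 1, by omega⟩
    have h3 : ((m : ℝ) + 1) * (m.choose l : ℝ) = ((m + 1).choose (l + 1) : ℝ) * (l + 1) := by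
      exact_mod_cast Nat.add_one_mul_choose_eq m l
    have h4 : (0 : ℝ) < ((m + 1).choose (l + 1) : ℝ) := by exact_mod_cast Nat.choose_pos hk
    rw [div_eq_div_iff h4.ne' (by positivity)]
    push_cast
    linarith

theorem expect_piFinset_prod {ι : Type*} [Fintype ι] [DecidableEq ι] {α : ι → Type*}
    (t : ∀ i, Finset (α i)) (f : ∀ i, α i → ℝ) :
    𝔼 S ∈ Fintype.piFinset t, ∏ i, f i (S i) = ∏ i, 𝔼 a ∈ t i, f i a := by
  simp_rw [expect_eq_sum_div_card]
  rw [prod_div_distrib, prod_univ_sum, Fintype.card_piFinset, Nat.cast_prod]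

/-! ### Edge probabilities of the sampled graph -/

section Sampling

variable {V : Type*} {G : SimpleGraph V} {x : Sym2 V → ℝ} {ε d : ℝ} {γ : ℕ}

theorem mem_levelGraph_edgeSet {e : Sym2 V} {i : ℕ} :
    e ∈ (levelGraph G x ε i).edgeSet ↔ e ∈ G.edgeSet ∧
      (1 + ε) ^ (-(i : ℤ)) < x e ∧ x e ≤ (1 + ε) ^ (-(i : ℤ) + 1) := by
  rw [levelGraph, SimpleGraph.edgeSet_fromEdgeSet]
  constructor
  · exact fun h => h.1
  · exact fun h => ⟨h, G.not_isDiag_of_mem_edgeSet h.1⟩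

theorem level_le_of_mem (hε : 0 < ε) {e : Sym2 V} {i j : ℕ}
    (hi : e ∈ (levelGraph G x ε i).edgeSet) (hj : e ∈ (levelGraph G x ε j).edgeSet) : j ≤ i := by
  have h := (mem_levelGraph_edgeSet.1 hi).2.1.trans_le (mem_levelGraph_edgeSet.1 hj).2.2
  rw [zpow_lt_zpow_iff_right₀ (by linarith)] at h
  omega

variable [Fintype V]

theorem level_eq_of_mem (hε : 0 < ε) {e : Sym2 V} {i j : Level (Fintype.card V) ε}
    (hi : e ∈ (levelGraph G x ε i).edgeSet) (hj : e ∈ (levelGraph G x ε j).edgeSet) : i = j :=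
  Subtype.ext (le_antisymm (level_le_of_mem hε hj hi) (level_le_of_mem hε hi hj))

variable (G x ε γ d) in
/-- The probability that the edge `e` belongs to the sampled graph. -/
noncomputable def edgeRate (e : Sym2 V) : ℝ :=
  ∑ i : Level (Fintype.card V) ε, if e ∈ (levelGraph G x ε i).edgeSet then
    (numSampled γ ε d i : ℝ) / numColors γ ε i else 0

theorem edgeRate_eq (hε : 0 < ε) {e : Sym2 V} {i : Level (Fintype.card V) ε}
    (hi : e ∈ (levelGraph G x ε i).edgeSet) :
    edgeRate G x ε d γ e = (numSampled γ ε d i : ℝ) / numColors γ ε i := by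
  rw [edgeRate, sum_eq_single i, if_pos hi]
  · exact fun j _ hj => if_neg fun h => hj (level_eq_of_mem hε h hi)
  · simp

theorem edgeRate_eq_zero {e : Sym2 V}
    (h : ¬ ∃ i : Level (Fintype.card V) ε, e ∈ (levelGraph G x ε i).edgeSet) :
    edgeRate G x ε d γ e = 0 :=
  sum_eq_zero fun i _ => if_neg fun hi => h ⟨i, hi⟩

theorem edgeRate_nonneg (e : Sym2 V) : 0 ≤ edgeRate G x ε d γ e :=
  sum_nonneg fun i _ => by split_ifs <;> positivity

theorem numSampled_le (γ : ℕ) (ε d : ℝ) (i : ℕ) : numSampled γ ε d i ≤ numColors γ ε i :=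
  min_le_right _ _

theorem edgeRate_le_one (hε : 0 < ε) (e : Sym2 V) : edgeRate G x ε d γ e ≤ 1 := by
  by_cases h : ∃ i : Level (Fintype.card V) ε, e ∈ (levelGraph G x ε i).edgeSet
  · obtain ⟨i, hi⟩ := h
    rw [edgeRate_eq hε hi]
    exact div_le_one_of_le₀ (by exact_mod_cast numSampled_le γ ε d i) (Nat.cast_nonneg _)
  · rw [edgeRate_eq_zero h]; exact zero_le_one

variable (χ : LevelColorings G x ε γ)

theorem mem_sampledGraph_edgeSet {e : Sym2 V}
    {S : ∀ i : Level (Fintype.card V) ε, Finset (Fin (numColors γ ε i))} :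
    e ∈ (sampledGraph χ S).edgeSet ↔ ∃ i : Level (Fintype.card V) ε,
      ∃ h : e ∈ (levelGraph G x ε i).edgeSet, χ i ⟨e, h⟩ ∈ S i := by
  rw [sampledGraph, SimpleGraph.edgeSet_fromEdgeSet]
  constructor
  · exact fun h => h.1
  · exact fun h => ⟨h, SimpleGraph.not_isDiag_of_mem_edgeSet _ h.choose_spec.choose⟩

theorem sampledGraph_le (S : ∀ i : Level (Fintype.card V) ε, Finset (Fin (numColors γ ε i))) :
    sampledGraph χ S ≤ G := by
  rw [← SimpleGraph.edgeSet_subset_edgeSet]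
  intro e he
  obtain ⟨i, h, -⟩ := (mem_sampledGraph_edgeSet χ).1 he
  exact (mem_levelGraph_edgeSet.1 h).1

/-- The colors used on the edges of `T` in a given level. -/
noncomputable def colorsOf (T : Finset (Sym2 V)) (i : Level (Fintype.card V) ε) :
    Finset (Fin (numColors γ ε i)) :=
  (T.subtype (· ∈ (levelGraph G x ε i).edgeSet)).image (χ i)

/-- Distinct edges through `w` are adjacent in the line graph, so a proper coloring is injective on
them. -/
theorem card_colorsOf {w : V} {T : Finset (Sym2 V)} (hT : ∀ e ∈ T, w ∈ e)
    (i : Level (Fintype.card V) ε) :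
    #(colorsOf χ T i) = #{e ∈ T | e ∈ (levelGraph G x ε i).edgeSet} := by
  rw [colorsOf, card_image_of_injOn, card_subtype]
  intro e he f hf hef
  by_contra hne
  refine (χ i).valid ?_ hef
  rw [SimpleGraph.lineGraph_adj_iff_exists]
  exact ⟨hne, w, hT _ (by simpa using he), hT _ (by simpa using hf)⟩

theorem expect_subset_sampledGraph (hε : 0 < ε) {T : Finset (Sym2 V)}
    (hT : ∀ e ∈ T, ∃ i : Level (Fintype.card V) ε, e ∈ (levelGraph G x ε i).edgeSet) :
    𝔼 S ∈ samples (Fintype.card V) γ ε d,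
        (if ∀ e ∈ T, e ∈ (sampledGraph χ S).edgeSet then (1 : ℝ) else 0) =
      ∏ i : Level (Fintype.card V) ε,
        𝔼 S ∈ powersetCard (numSampled γ ε d i) (univ : Finset (Fin (numColors γ ε i))),
          (if colorsOf χ T i ⊆ S then (1 : ℝ) else 0) := by
  rw [samples, ← expect_piFinset_prod]
  refine expect_congr rfl fun S _ => ?_
  have : (∀ e ∈ T, e ∈ (sampledGraph χ S).edgeSet) ↔
      ∀ i ∈ (univ : Finset (Level (Fintype.card V) ε)), colorsOf χ T i ⊆ S i := by
    constructor
    · intro h i _ a ha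
      obtain ⟨e, he, rfl⟩ := mem_image.1 ha
      obtain ⟨j, hj, hS⟩ := (mem_sampledGraph_edgeSet χ).1 (h e (by simpa using he))
      obtain rfl := level_eq_of_mem hε e.2 hj
      exact hS
    · intro h e he
      obtain ⟨i, hi⟩ := hT e he
      exact (mem_sampledGraph_edgeSet χ).2 ⟨i, hi, h i (mem_univ _)
        (mem_image.2 ⟨⟨e, hi⟩, by simpa using he, rfl⟩)⟩
  by_cases h : ∀ e ∈ T, e ∈ (sampledGraph χ S).edgeSet
  · rw [if_pos h, prod_eq_one fun i hi => if_pos (this.1 h i hi)]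
  · rw [if_neg h]
    rw [this] at h
    push Not at h
    obtain ⟨i, hi, hS⟩ := h
    exact (prod_eq_zero hi (if_neg hS)).symm

theorem expect_subset_sampledGraph_le (hε : 0 < ε) {w : V} {T : Finset (Sym2 V)}
    (hT : ∀ e ∈ T, w ∈ e) :
    𝔼 S ∈ samples (Fintype.card V) γ ε d,
        (if ∀ e ∈ T, e ∈ (sampledGraph χ S).edgeSet then (1 : ℝ) else 0) ≤
      ∏ e ∈ T, edgeRate G x ε d γ e := by
  by_cases hlev : ∀ e ∈ T, ∃ i : Level (Fintype.card V) ε, e ∈ (levelGraph G x ε i).edgeSet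
  · rw [expect_subset_sampledGraph χ hε hlev]
    have hprod : ∏ e ∈ T, edgeRate G x ε d γ e = ∏ i : Level (Fintype.card V) ε,
        ∏ e ∈ T with e ∈ (levelGraph G x ε i).edgeSet, edgeRate G x ε d γ e := by
      simp_rw [prod_filter]
      rw [prod_comm]
      refine prod_congr rfl fun e he => ?_
      obtain ⟨i, hi⟩ := hlev e he
      rw [prod_eq_single i, if_pos hi]
      · exact fun j _ hj => if_neg fun h => hj (level_eq_of_mem hε h hi)
      · simp
    rw [hprod]
    refine prod_le_prod (fun i _ => expect_nonneg fun S _ => by split_ifs <;> simp) fun i _ => ?_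
    refine (expect_subset_powersetCard_le (numSampled_le γ ε d i) _).trans_eq ?_
    rw [card_colorsOf χ hT, ← prod_const]
    exact prod_congr rfl fun e he => (edgeRate_eq hε (mem_filter.1 he).2).symm
  -- An edge in no level is never sampled, so the left side vanishes.
  · push Not at hlev
    obtain ⟨e, he, hlev⟩ := hlev
    rw [expect_eq_zero]
    · exact prod_nonneg fun e _ => edgeRate_nonneg e
    · intro S _
      refine if_neg fun h => ?_
      obtain ⟨i, hi, -⟩ := (mem_sampledGraph_edgeSet χ).1 (h e he)
      exact hlev i hi

theorem expect_mem_sampledGraph (hε : 0 < ε) (e : Sym2 V) :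
    𝔼 S ∈ samples (Fintype.card V) γ ε d,
        (if e ∈ (sampledGraph χ S).edgeSet then (1 : ℝ) else 0) = edgeRate G x ε d γ e := by
  by_cases hlev : ∃ i : Level (Fintype.card V) ε, e ∈ (levelGraph G x ε i).edgeSet
  · have h := expect_subset_sampledGraph (d := d) χ hε (T := {e}) (by simpa using hlev)
    simp only [mem_singleton, forall_eq] at h
    obtain ⟨i, hi⟩ := hlev
    rw [h, prod_eq_single i, edgeRate_eq hε hi]
    · have : colorsOf χ {e} i = {χ i ⟨e, hi⟩} := by
        ext a
        simp only [colorsOf, mem_image, mem_subtype, mem_singleton]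
        constructor
        · rintro ⟨f, rfl, rfl⟩; rfl
        · rintro rfl; exact ⟨_, rfl, rfl⟩
      rw [this]
      exact expect_mem_powersetCard (numSampled_le γ ε d i) _
    · intro j _ hj
      have : colorsOf χ {e} j = ∅ := by
        refine eq_empty_of_forall_notMem fun a ha => ?_
        obtain ⟨f, hf, -⟩ := mem_image.1 ha
        simp only [mem_subtype, mem_singleton] at hf
        exact hj (level_eq_of_mem hε (hf ▸ f.2) hi)
      simp only [this, empty_subset, if_true]
      exact expect_const (powersetCard_nonempty.2 (by simpa using numSampled_le γ ε d j)) _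
    · simp
  · rw [edgeRate_eq_zero hlev]
    refine expect_eq_zero fun S _ => if_neg fun h => ?_
    obtain ⟨i, hi, -⟩ := (mem_sampledGraph_edgeSet χ).1 h
    exact hlev ⟨i, hi⟩

end Sampling

/-! ### Integration against the image of a uniform distribution -/

section Integration

variable {V : Type*} [Fintype V]

/-- A graph is determined by its measurable edge set. As there are finitely many graphs, every event
is measurable and integrals become finite averages. -/
instance : MeasurableSingletonClass (SimpleGraph V) :=
  ⟨fun H => by
    have : ({H} : Set (SimpleGraph V)) = SimpleGraph.edgeSet ⁻¹' {H.edgeSet} := by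
      ext K; simp
    rw [this]
    exact SimpleGraph.measurable_edgeSet (measurableSet_singleton _)⟩

theorem integral_map_uniformOfFinset {Ω α : Type*} [Finite Ω] [MeasurableSpace α]
    [MeasurableSingletonClass α] [Finite α] (s : Finset Ω) (hs : s.Nonempty) (g : Ω → α)
    (f : α → ℝ) :
    ∫ a, f a ∂((PMF.uniformOfFinset s hs).map g).toMeasure = 𝔼 ω ∈ s, f (g ω) := by
  have := Fintype.ofFinite Ω
  let _ : MeasurableSpace Ω := ⊤
  have hg : Measurable g := measurable_from_top
  rw [← PMF.toMeasure_map g _ hg, integral_map hg.aemeasurable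
      (measurable_of_finite f).aestronglyMeasurable, PMF.integral_eq_sum, expect_eq_sum_div_card]
  simp only [PMF.uniformOfFinset_apply, smul_eq_mul]
  rw [sum_div, ← sum_subset (subset_univ s)]
  · refine sum_congr rfl fun ω hω => ?_
    rw [if_pos hω]
    simp [div_eq_inv_mul]
  · intro ω _ hω
    simp [hω]

theorem measureReal_map_uniformOfFinset {Ω α : Type*} [Finite Ω] [MeasurableSpace α]
    [MeasurableSingletonClass α] [Finite α] (s : Finset Ω) (hs : s.Nonempty) (g : Ω → α)
    (B : Set α) :
    ((PMF.uniformOfFinset s hs).map g).toMeasure.real B =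
      𝔼 ω ∈ s, if g ω ∈ B then (1 : ℝ) else 0 := by
  rw [← integral_indicator_one (Set.toFinite B).measurableSet, integral_map_uniformOfFinset]
  simp [Set.indicator_apply]

theorem integral_cond_map_uniformOfFinset {Ω α : Type*} [Finite Ω] [MeasurableSpace α]
    [MeasurableSingletonClass α] [Finite α] (s : Finset Ω) (hs : s.Nonempty) (g : Ω → α)
    (B : Set α) (f : α → ℝ) :
    ∫ a, f a ∂(((PMF.uniformOfFinset s hs).map g).toMeasure[|B]) =
      (𝔼 ω ∈ s, if g ω ∈ B then f (g ω) else 0) /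
        ((PMF.uniformOfFinset s hs).map g).toMeasure.real B := by
  rw [ProbabilityTheory.cond, integral_smul_measure,
    ← integral_indicator (Set.toFinite B).measurableSet, integral_map_uniformOfFinset]
  simp only [Set.indicator_apply, measureReal_def, ENNReal.toReal_inv, smul_eq_mul]
  rw [div_eq_inv_mul]

end Integration

/-! ### Edge probabilities in terms of the fractional matching -/

/-- With `log(1+ε) ≥ ε - ε²/2` the exponent is at most `-dε²(3/2 - 2ε) ≤ -dε²`, and `dε² ≥ 4
log(2/ε)`. -/
theorem exp_tail_le {ε d μ : ℝ} (hε : 0 < ε) (hε4 : ε < 1 / 4)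
    (hd : 4 * Real.log (2 / ε) / ε ^ 2 ≤ d) (hd0 : 0 < d) (hμ : μ ≤ d * (1 + 2 * ε)) :
    Real.exp (ε * μ - d * (1 + 4 * ε) * Real.log (1 + ε)) ≤ (ε / 2) ^ 4 := by
  have hlog : ε - ε ^ 2 / 2 ≤ Real.log (1 + ε) := by
    refine le_trans ?_ (Real.le_log_one_add_of_nonneg hε.le)
    rw [le_div_iff₀ (by positivity)]
    nlinarith [pow_pos hε 3]
  have h1 : d * (1 + 4 * ε) * (ε - ε ^ 2 / 2) ≤ d * (1 + 4 * ε) * Real.log (1 + ε) :=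
    mul_le_mul_of_nonneg_left hlog (by positivity)
  have h2 : ε * μ ≤ ε * (d * (1 + 2 * ε)) := mul_le_mul_of_nonneg_left hμ hε.le
  have h3 : 4 * Real.log (2 / ε) ≤ d * ε ^ 2 := by rwa [div_le_iff₀ (by positivity)] at hd
  have h4 : 0 ≤ d * ε ^ 2 * (1 / 4 - ε) := mul_nonneg (by positivity) (by linarith)
  calc Real.exp (ε * μ - d * (1 + 4 * ε) * Real.log (1 + ε))
      ≤ Real.exp (-(4 * Real.log (2 / ε))) := Real.exp_le_exp.2 (by nlinarith)
    _ = Real.exp (Real.log ((ε / 2) ^ 4)) := by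
        rw [Real.log_pow, ← inv_div ε 2, Real.log_inv]; push_cast; ring_nf
    _ = (ε / 2) ^ 4 := Real.exp_log (by positivity)

section Rate

variable {V : Type*} {G : SimpleGraph V} {x : Sym2 V → ℝ} {ε d : ℝ} {γ : ℕ}

theorem numSampled_div_numColors (hγ : 1 ≤ γ) (i : ℕ) :
    (numSampled γ ε d i : ℝ) / numColors γ ε i =
      min (⌈d * (1 + ε)⌉₊ : ℝ) ⌈(1 + ε) ^ i⌉₊ / ⌈(1 + ε) ^ i⌉₊ := by
  have hγ' : (0 : ℝ) < γ := by exact_mod_cast hγ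
  rw [numSampled, numColors, Nat.mul_min_mul_left, Nat.cast_mul, Nat.cast_mul, Nat.cast_min,
    mul_div_mul_left _ _ hγ'.ne']

theorem one_lt_mul_pow_of_mem (hε : 0 < ε) {e : Sym2 V} {i : ℕ}
    (hi : e ∈ (levelGraph G x ε i).edgeSet) : 1 < x e * (1 + ε) ^ i := by
  have h := (mem_levelGraph_edgeSet.1 hi).2.1
  rwa [zpow_neg, zpow_natCast, inv_lt_iff_one_lt_mul₀' (by positivity), mul_comm] at h

theorem mul_pow_le_of_mem (hε : 0 < ε) {e : Sym2 V} {i : ℕ}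
    (hi : e ∈ (levelGraph G x ε i).edgeSet) : x e * (1 + ε) ^ i ≤ 1 + ε := by
  have h := (mem_levelGraph_edgeSet.1 hi).2.2
  have hp : (0 : ℝ) < (1 + ε) ^ i := by positivity
  rw [zpow_add₀ (by positivity), zpow_neg, zpow_natCast, zpow_one] at h
  calc x e * (1 + ε) ^ i ≤ ((1 + ε) ^ i)⁻¹ * (1 + ε) * (1 + ε) ^ i :=
        mul_le_mul_of_nonneg_right h hp.le
    _ = 1 + ε := by field_simp

variable [Fintype V]

theorem edgeRate_le (hε : 0 < ε) (hγ : 1 ≤ γ) (hd : 1 ≤ ε * d) {e : Sym2 V} (hx : 0 ≤ x e) :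
    edgeRate G x ε d γ e ≤ d * (1 + 2 * ε) * x e := by
  have hd0 : 0 < d := pos_of_mul_pos_right (one_pos.trans_le hd) hε.le
  by_cases h : ∃ i : Level (Fintype.card V) ε, e ∈ (levelGraph G x ε i).edgeSet
  · obtain ⟨i, hi⟩ := h
    have hp : (0 : ℝ) < (1 + ε) ^ (i : ℕ) := by positivity
    have hN : (1 + ε) ^ (i : ℕ) ≤ (⌈(1 + ε) ^ (i : ℕ)⌉₊ : ℝ) := Nat.le_ceil _
    -- The rounding error `1` is absorbed by `1 ≤ ε d`, turning `1 + ε` into `1 + 2ε`.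
    have hk : (⌈d * (1 + ε)⌉₊ : ℝ) < d * (1 + ε) + 1 := Nat.ceil_lt_add_one (by positivity)
    have h1 := one_lt_mul_pow_of_mem hε hi
    rw [edgeRate_eq hε hi, numSampled_div_numColors hγ, div_le_iff₀ (hp.trans_le hN)]
    calc min (⌈d * (1 + ε)⌉₊ : ℝ) _ ≤ d * (1 + 2 * ε) * 1 :=
          (min_le_left _ _).trans (by nlinarith)
      _ ≤ d * (1 + 2 * ε) * (x e * ⌈(1 + ε) ^ (i : ℕ)⌉₊) := by
          refine mul_le_mul_of_nonneg_left ?_ (by positivity)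
          exact h1.le.trans (mul_le_mul_of_nonneg_left hN hx)
      _ = _ := by ring
  · rw [edgeRate_eq_zero h]; positivity

/-- On such a level `(1+ε)^i ≤ d(1+ε)`, so the whole palette is sampled. -/
theorem edgeRate_eq_one (hε : 0 < ε) (hγ : 1 ≤ γ) (hd : 0 < d) {e : Sym2 V}
    {i : Level (Fintype.card V) ε} (hi : e ∈ (levelGraph G x ε i).edgeSet) (hx : 1 / d < x e) :
    edgeRate G x ε d γ e = 1 := by
  have hp : (0 : ℝ) < (1 + ε) ^ (i : ℕ) := by positivity
  have hN : (1 + ε) ^ (i : ℕ) ≤ (⌈(1 + ε) ^ (i : ℕ)⌉₊ : ℝ) := Nat.le_ceil _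
  have h1 : (1 + ε) ^ (i : ℕ) ≤ d * (1 + ε) := by
    have h2 := mul_pow_le_of_mem hε hi
    rw [div_lt_iff₀ hd] at hx
    nlinarith [mul_le_mul_of_nonneg_right hx.le hp.le]
  rw [edgeRate_eq hε hi, numSampled_div_numColors hγ,
    min_eq_right (by exact_mod_cast Nat.ceil_mono h1), div_self (hp.trans_le hN).ne']

/-- The levels tile `((1+ε)^{-L}, 1]`, and `L` is large enough that `(1+ε)^L ≥ (n/ε)²`. -/
theorem le_sq_of_forall_notMem_levelGraph (hε : 0 < ε) {e : Sym2 V} (he : e ∈ G.edgeSet)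
    (hx : x e ≤ 1)
    (h : ¬ ∃ i : Level (Fintype.card V) ε, e ∈ (levelGraph G x ε i).edgeSet) :
    x e ≤ (ε / Fintype.card V) ^ 2 := by
  have hn : (0 : ℝ) < Fintype.card V := by
    have : Nonempty V := ⟨e.out.1⟩
    exact_mod_cast Fintype.card_pos
  set L := numLevels (Fintype.card V) ε with hL
  have hpow : ((Fintype.card V : ℝ) / ε) ^ 2 ≤ (1 + ε) ^ L := by
    have h1 : 2 * Real.logb (1 + ε) ((Fintype.card V : ℝ) / ε) ≤ L := Nat.le_ceil _
    have h2 : Real.logb (1 + ε) (((Fintype.card V : ℝ) / ε) ^ 2) ≤ L := by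
      rw [Real.logb_pow]; exact_mod_cast h1
    rw [Real.logb_le_iff_le_rpow (by linarith) (by positivity)] at h2
    exact_mod_cast h2
  have hL1 : x e ≤ (1 + ε) ^ (-(L : ℤ)) := by
    by_contra hlt
    push Not at hlt
    -- The least such `i` is the level of `e`; it is not `0` because `x e ≤ 1`.
    have hex : ∃ i : ℕ, (1 + ε) ^ (-(i : ℤ)) < x e := ⟨L, hlt⟩
    have hspec := Nat.find_spec hex
    have hle : Nat.find hex ≤ L := Nat.find_min' hex hlt
    have hpos : 1 ≤ Nat.find hex := by
      by_contra h0
      have h0 : Nat.find hex = 0 := by omega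
      rw [h0] at hspec
      simp only [Nat.cast_zero, neg_zero, zpow_zero] at hspec
      linarith
    have hmin := Nat.find_min hex (m := Nat.find hex - 1) (by omega)
    refine h ⟨⟨Nat.find hex, mem_Icc.2 ⟨hpos, hle⟩⟩,
      mem_levelGraph_edgeSet.2 ⟨he, hspec, ?_⟩⟩
    push Not at hmin
    rwa [show -((Nat.find hex - 1 : ℕ) : ℤ) = -(Nat.find hex : ℤ) + 1 by omega] at hmin
  refine hL1.trans ?_
  rw [zpow_neg, zpow_natCast, ← inv_div, inv_pow]
  exact inv_anti₀ (by positivity) hpow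

/-- The subtracted `(ε/n)²` covers edges below all levels, whose rate is `0`. Otherwise the factor
`1 - ε` pays for rounding up the palette size. -/
theorem le_edgeRate (hε : 0 < ε) (hε1 : ε < 1) (hγ : 1 ≤ γ) (hd : 1 ≤ ε * d) {e : Sym2 V}
    (he : e ∈ G.edgeSet) (hx : 0 ≤ x e) (hxd : x e ≤ 1 / d) :
    (1 - ε) * d * (x e - (ε / Fintype.card V) ^ 2) ≤ edgeRate G x ε d γ e := by
  have hd0 : 0 < d := pos_of_mul_pos_right (one_pos.trans_le hd) hε.le
  have hc : 0 ≤ (1 - ε) * d := mul_nonneg (by linarith) hd0.le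
  have hxd' : x e * d ≤ 1 := by rwa [le_div_iff₀ hd0] at hxd
  by_cases h : ∃ i : Level (Fintype.card V) ε, e ∈ (levelGraph G x ε i).edgeSet
  · refine (mul_le_mul_of_nonneg_left (sub_le_self _ (sq_nonneg _)) hc).trans ?_
    obtain ⟨i, hi⟩ := h
    have hp : (0 : ℝ) < (1 + ε) ^ (i : ℕ) := by positivity
    have hN : (1 + ε) ^ (i : ℕ) ≤ (⌈(1 + ε) ^ (i : ℕ)⌉₊ : ℝ) := Nat.le_ceil _
    have hN' : (⌈(1 + ε) ^ (i : ℕ)⌉₊ : ℝ) < (1 + ε) ^ (i : ℕ) + 1 := Nat.ceil_lt_add_one hp.le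
    have hk : d * (1 + ε) ≤ (⌈d * (1 + ε)⌉₊ : ℝ) := Nat.le_ceil _
    have h1 := mul_pow_le_of_mem hε hi
    rw [edgeRate_eq hε hi, numSampled_div_numColors hγ, le_div_iff₀ (hp.trans_le hN)]
    refine le_min ?_ ?_
    · refine le_trans ?_ hk
      calc (1 - ε) * d * x e * ⌈(1 + ε) ^ (i : ℕ)⌉₊
          ≤ (1 - ε) * d * x e * ((1 + ε) ^ (i : ℕ) + 1) :=
            mul_le_mul_of_nonneg_left hN'.le (mul_nonneg hc hx)
        _ = (1 - ε) * d * (x e * (1 + ε) ^ (i : ℕ)) + (1 - ε) * (x e * d) := by ring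
        _ ≤ (1 - ε) * d * (1 + ε) + (1 - ε) * 1 :=
            add_le_add (mul_le_mul_of_nonneg_left h1 hc)
              (mul_le_mul_of_nonneg_left hxd' (by linarith))
        _ ≤ d * (1 + ε) := by nlinarith [mul_pos hε hd0, mul_pos hε (mul_pos hε hd0)]
    · refine mul_le_of_le_one_left (Nat.cast_nonneg _) ?_
      nlinarith [mul_nonneg hx hd0.le]
  · rw [edgeRate_eq_zero h]
    refine mul_nonpos_of_nonneg_of_nonpos hc ?_
    have hd1 : 1 / d ≤ 1 := by
      rw [div_le_one hd0]; nlinarith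
    linarith [le_sq_of_forall_notMem_levelGraph hε he (hxd.trans hd1) h]

theorem sum_edgeRate_le (hε : 0 < ε) (hγ : 1 ≤ γ) (hd : 1 ≤ ε * d)
    (hx : IsFractionalMatching G x) (w : V) :
    ∑ e ∈ G.incidenceFinset w, edgeRate G x ε d γ e ≤ d * (1 + 2 * ε) := by
  have hd0 : 0 < d := pos_of_mul_pos_right (one_pos.trans_le hd) hε.le
  calc ∑ e ∈ G.incidenceFinset w, edgeRate G x ε d γ e
      ≤ ∑ e ∈ G.incidenceFinset w, d * (1 + 2 * ε) * x e :=
        sum_le_sum fun e he => edgeRate_le hε hγ hd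
          (hx.nonneg e (G.incidenceSet_subset w ((G.mem_incidenceFinset w e).1 he)))
    _ ≤ d * (1 + 2 * ε) := by
        rw [← mul_sum]
        exact mul_le_of_le_one_right (by positivity) (hx.sum_le_one w)

theorem le_sum_edgeRate {c : ℝ} (hε : 0 < ε) (hε1 : ε < 1) (hγ : 1 ≤ γ) (hd : 1 ≤ ε * d)
    (hc : 0 < c) (hcn : ε * c ≤ Fintype.card V) (hx : IsFractionalMatching G x) {v : V}
    (hv : 1 / c ≤ ∑ e ∈ G.incidenceFinset v, x e)
    (hvd : ∀ e ∈ G.incidenceFinset v, x e ≤ 1 / d) :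
    (1 - ε) ^ 2 * (d / c) ≤ ∑ e ∈ G.incidenceFinset v, edgeRate G x ε d γ e := by
  have hd0 : 0 < d := pos_of_mul_pos_right (one_pos.trans_le hd) hε.le
  have hn : (0 : ℝ) < Fintype.card V := (mul_pos hε hc).trans_le hcn
  have hmem : ∀ e ∈ G.incidenceFinset v, e ∈ G.edgeSet := fun e he =>
    G.incidenceSet_subset v ((G.mem_incidenceFinset v e).1 he)
  have hcard : (#(G.incidenceFinset v) : ℝ) ≤ Fintype.card V := by
    rw [G.card_incidenceFinset_eq_degree]
    exact_mod_cast (G.degree_lt_card_verts v).le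
  -- At most `n` edges lose `(ε/n)²` each, and `ε²/n ≤ ε/c` by `hcn`.
  have hsmall : #(G.incidenceFinset v) * (ε / Fintype.card V) ^ 2 ≤ ε / c := by
    calc #(G.incidenceFinset v) * (ε / Fintype.card V) ^ 2
        ≤ Fintype.card V * (ε / Fintype.card V) ^ 2 :=
          mul_le_mul_of_nonneg_right hcard (by positivity)
      _ = ε ^ 2 / Fintype.card V := by field_simp
      _ ≤ ε / c := by
          rw [div_le_div_iff₀ hn hc]
          nlinarith [mul_le_mul_of_nonneg_left hcn hε.le]
  calc (1 - ε) ^ 2 * (d / c) = (1 - ε) * d * (1 / c - ε / c) := by field_simp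
    _ ≤ (1 - ε) * d * ((∑ e ∈ G.incidenceFinset v, x e) -
          #(G.incidenceFinset v) * (ε / Fintype.card V) ^ 2) :=
        mul_le_mul_of_nonneg_left (by linarith) (mul_nonneg (by linarith) hd0.le)
    _ = ∑ e ∈ G.incidenceFinset v, (1 - ε) * d * (x e - (ε / Fintype.card V) ^ 2) := by
        rw [← mul_sum, sum_sub_distrib, sum_const, nsmul_eq_mul]
    _ ≤ _ := sum_le_sum fun e he =>
        le_edgeRate hε hε1 hγ hd (hmem e he) (hx.nonneg e (hmem e he)) (hvd e he)

end Rate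

/-! ### Trimming -/

section Trim

variable {V : Type*} [Fintype V]

theorem degree_eq_card_inter {G H : SimpleGraph V} (h : H ≤ G) (w : V) :
    H.degree w = #(({e | e ∈ H.edgeSet} : Finset (Sym2 V)) ∩ G.incidenceFinset w) := by
  rw [← H.card_incidenceFinset_eq_degree]
  congr 1
  ext e
  simp only [SimpleGraph.mem_incidenceFinset, SimpleGraph.incidenceSet, Set.mem_ofPred_eq, mem_inter,
    mem_filter, mem_univ, true_and]
  exact ⟨fun he => ⟨he.1, SimpleGraph.edgeSet_subset_edgeSet.2 h he.1, he.2⟩,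
    fun he => ⟨he.1, he.2.2⟩⟩

theorem mem_trim_edgeSet {H : SimpleGraph V} {D : ℝ} {e : Sym2 V} :
    e ∈ (trim H D).edgeSet ↔ e ∈ H.edgeSet ∧ ∀ w ∈ e, (H.degree w : ℝ) ≤ D := by
  induction e with
  | h u v => simp [trim]

theorem trim_le (H : SimpleGraph V) (D : ℝ) : trim H D ≤ H := fun _ _ h => h.1

theorem degree_trim_le (H : SimpleGraph V) {D : ℝ} (hD : 0 ≤ D) (v : V) :
    ((trim H D).degree v : ℝ) ≤ D := by
  by_cases h : (H.degree v : ℝ) ≤ D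
  · refine le_trans ?_ h
    exact_mod_cast SimpleGraph.degree_le_of_le (trim_le H D)
  · have : (trim H D).degree v = 0 := by
      rw [← SimpleGraph.card_neighborFinset_eq_degree, card_eq_zero]
      refine eq_empty_of_forall_notMem fun w hw => h ?_
      exact ((SimpleGraph.mem_neighborFinset _ _ _).1 hw).2.1
    rw [this]; exact_mod_cast hD

theorem degree_le_maxDegree (H : SimpleGraph V) {e : Sym2 V} {v : V} (hv : v ∈ e) :
    H.degree v ≤ maxDegree H e :=
  le_sup (f := fun v => H.degree v) (Sym2.mem_toFinset.2 hv)

end Trim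

/-! ### Expected degrees -/

section Degrees

variable {V : Type*} [Fintype V] {G : SimpleGraph V} {x : Sym2 V → ℝ} {ε d : ℝ} {γ : ℕ}
  (χ : LevelColorings G x ε γ)

theorem expect_mem_and_lt_degree_le (hε : 0 < ε) (hε4 : ε < 1 / 4)
    (hd : 4 * Real.log (2 / ε) / ε ^ 2 ≤ d) (hγ : 1 ≤ γ) (hd1 : 1 ≤ ε * d)
    (hx : IsFractionalMatching G x) {w : V} {f : Sym2 V} (hf : f ∈ G.incidenceFinset w) :
    𝔼 S ∈ samples (Fintype.card V) γ ε d, (if f ∈ (sampledGraph χ S).edgeSet ∧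
        d * (1 + 4 * ε) < (sampledGraph χ S).degree w then (1 : ℝ) else 0) ≤
      (1 + ε) * (ε / 2) ^ 4 * edgeRate G x ε d γ f := by
  have hd0 : 0 < d := pos_of_mul_pos_right (one_pos.trans_le hd1) hε.le
  have h := expect_mem_and_lt_card_le (samples (Fintype.card V) γ ε d)
    (fun S => ({e | e ∈ (sampledGraph χ S).edgeSet} : Finset (Sym2 V)))
    (G.incidenceFinset w) (edgeRate G x ε d γ) edgeRate_nonneg (fun T hT => by
      have h := expect_subset_sampledGraph_le (d := d) χ hε (w := w) (T := T) fun e he =>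
        ((G.mem_incidenceFinset w e).1 (hT he)).2
      refine le_trans (le_of_eq ?_) h
      refine expect_congr rfl fun S _ => if_congr ?_ rfl rfl
      simp [subset_iff]) hε.le (d * (1 + 4 * ε)) hf
  refine le_trans (le_of_eq ?_) (h.trans ?_)
  · refine expect_congr rfl fun S _ => if_congr ?_ rfl rfl
    rw [degree_eq_card_inter (sampledGraph_le χ S)]
    simp
  · refine mul_le_mul_of_nonneg_right ?_ (edgeRate_nonneg f)
    exact mul_le_mul_of_nonneg_left
      (exp_tail_le hε hε4 hd hd0 (sum_edgeRate_le hε hγ hd1 hx w)) (by positivity)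

theorem expect_mem_and_notMem_trim_le (hε : 0 < ε) (hε4 : ε < 1 / 4)
    (hd : 4 * Real.log (2 / ε) / ε ^ 2 ≤ d) (hγ : 1 ≤ γ) (hd1 : 1 ≤ ε * d)
    (hx : IsFractionalMatching G x) {f : Sym2 V} (hf : f ∈ G.edgeSet) :
    𝔼 S ∈ samples (Fintype.card V) γ ε d, (if f ∈ (sampledGraph χ S).edgeSet ∧
        f ∉ (trim (sampledGraph χ S) (d * (1 + 4 * ε))).edgeSet then (1 : ℝ) else 0) ≤
      2 * ((1 + ε) * (ε / 2) ^ 4) * edgeRate G x ε d γ f := by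
  induction f with
  | h u v =>
    have hu := expect_mem_and_lt_degree_le χ hε hε4 hd hγ hd1 hx (w := u) (f := s(u, v))
      ((G.mem_incidenceFinset u _).2 ⟨hf, Sym2.mem_mk_left u v⟩)
    have hv := expect_mem_and_lt_degree_le χ hε hε4 hd hγ hd1 hx (w := v) (f := s(u, v))
      ((G.mem_incidenceFinset v _).2 ⟨hf, Sym2.mem_mk_right u v⟩)
    refine le_trans ?_ ((add_le_add hu hv).trans (le_of_eq (by ring)))
    rw [← expect_add_distrib]
    refine expect_le_expect fun S _ => ?_
    by_cases h1 : s(u, v) ∈ (sampledGraph χ S).edgeSet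
    · by_cases h2 : d * (1 + 4 * ε) < (sampledGraph χ S).degree u
      · rw [if_pos (⟨h1, h2⟩ : _ ∧ d * (1 + 4 * ε) < ((sampledGraph χ S).degree u : ℝ))]
        split_ifs <;> norm_num
      · by_cases h3 : d * (1 + 4 * ε) < (sampledGraph χ S).degree v
        · rw [if_pos (⟨h1, h3⟩ : _ ∧ d * (1 + 4 * ε) < ((sampledGraph χ S).degree v : ℝ))]
          split_ifs <;> norm_num
        · rw [if_neg]
          · exact add_nonneg (by split_ifs <;> simp) (by split_ifs <;> simp)
          · rintro ⟨-, h⟩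
            refine h (mem_trim_edgeSet.2 ⟨h1, fun w hw => ?_⟩)
            rcases Sym2.mem_iff.1 hw with rfl | rfl
            · exact not_lt.1 h2
            · exact not_lt.1 h3
    · simp [h1]

/-- An edge is missing after trimming either because it was not sampled or because it was sampled
and then trimmed. -/
theorem expect_notMem_trim_le (hε : 0 < ε) (hε4 : ε < 1 / 4)
    (hd : 4 * Real.log (2 / ε) / ε ^ 2 ≤ d) (hγ : 1 ≤ γ) (hd1 : 1 ≤ ε * d)
    (hx : IsFractionalMatching G x) {e : Sym2 V} (he : e ∈ G.edgeSet) :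
    𝔼 S ∈ samples (Fintype.card V) γ ε d,
        (if e ∉ (trim (sampledGraph χ S) (d * (1 + 4 * ε))).edgeSet then (1 : ℝ) else 0) ≤
      1 - edgeRate G x ε d γ e + 2 * ((1 + ε) * (ε / 2) ^ 4) := by
  have h1 := expect_mem_and_notMem_trim_le χ hε hε4 hd hγ hd1 hx he
  have h2 : 2 * ((1 + ε) * (ε / 2) ^ 4) * edgeRate G x ε d γ e ≤
      2 * ((1 + ε) * (ε / 2) ^ 4) :=
    mul_le_of_le_one_right (by positivity) (edgeRate_le_one hε e)
  have h0 : 𝔼 _S ∈ samples (Fintype.card V) γ ε d, (1 : ℝ) = 1 :=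
    expect_const (samples_nonempty (Fintype.card V) γ ε d) 1
  refine le_trans ?_ (add_le_add (sub_le_sub h0.le (expect_mem_sampledGraph χ hε e).ge)
    (h1.trans h2))
  rw [← expect_sub_distrib, ← expect_add_distrib]
  refine expect_le_expect fun S _ => ?_
  by_cases h3 : e ∈ (sampledGraph χ S).edgeSet <;>
  by_cases h4 : e ∈ (trim (sampledGraph χ S) (d * (1 + 4 * ε))).edgeSet <;> simp [h3, h4]

theorem le_expect_maxDegree (hε : 0 < ε) (hε4 : ε < 1 / 4)
    (hd : 4 * Real.log (2 / ε) / ε ^ 2 ≤ d) (hγ : 1 ≤ γ) (hd1 : 1 ≤ ε * d)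
    (hx : IsFractionalMatching G x) {e : Sym2 V} (he : e ∈ G.edgeSet) {v : V} (hv : v ∈ e) :
    ((∑ f ∈ G.incidenceFinset v, edgeRate G x ε d γ f) - edgeRate G x ε d γ e) *
        (1 - edgeRate G x ε d γ e - 2 * ((1 + ε) * (ε / 2) ^ 4)) ≤
      𝔼 S ∈ samples (Fintype.card V) γ ε d,
        (if e ∉ (trim (sampledGraph χ S) (d * (1 + 4 * ε))).edgeSet then
          (maxDegree (trim (sampledGraph χ S) (d * (1 + 4 * ε))) e : ℝ) else 0) := by
  set t := (1 + ε) * (ε / 2) ^ 4 with ht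
  set D := d * (1 + 4 * ε) with hD
  have hev : e ∈ G.incidenceFinset v := (G.mem_incidenceFinset v e).2 ⟨he, hv⟩
  calc ((∑ f ∈ G.incidenceFinset v, edgeRate G x ε d γ f) - edgeRate G x ε d γ e) *
        (1 - edgeRate G x ε d γ e - 2 * t)
      = ∑ f ∈ (G.incidenceFinset v).erase e, (edgeRate G x ε d γ f -
          edgeRate G x ε d γ f * edgeRate G x ε d γ e - 2 * t * edgeRate G x ε d γ f) := by
        rw [← sum_erase_eq_sub hev, sum_mul]
        exact sum_congr rfl fun f _ => by ring
    -- The integrand is a lower bound for the indicator of `f ∈ H'`, `e ∉ H'`: being sampled, minus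
    -- being sampled with `e`, minus being trimmed. Removing `e` from the sum makes each pair `{f,
    -- e}` genuine.
    _ ≤ ∑ f ∈ (G.incidenceFinset v).erase e, 𝔼 S ∈ samples (Fintype.card V) γ ε d,
          ((if f ∈ (sampledGraph χ S).edgeSet then (1 : ℝ) else 0) -
            (if ∀ g ∈ ({f, e} : Finset (Sym2 V)), g ∈ (sampledGraph χ S).edgeSet
              then (1 : ℝ) else 0) -
            (if f ∈ (sampledGraph χ S).edgeSet ∧ f ∉ (trim (sampledGraph χ S) D).edgeSet
              then (1 : ℝ) else 0)) := by
        refine sum_le_sum fun f hf => ?_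
        obtain ⟨hfe, hfv⟩ := mem_erase.1 hf
        have hfv := (G.mem_incidenceFinset v f).1 hfv
        rw [expect_sub_distrib, expect_sub_distrib, expect_mem_sampledGraph χ hε f]
        refine sub_le_sub (sub_le_sub le_rfl ?_)
          (expect_mem_and_notMem_trim_le χ hε hε4 hd hγ hd1 hx hfv.1)
        refine (expect_subset_sampledGraph_le (d := d) χ hε (w := v) ?_).trans_eq
          (prod_pair hfe)
        intro g hg
        rcases mem_insert.1 hg with rfl | hg
        · exact hfv.2
        · rw [mem_singleton.1 hg]; exact hv
    _ ≤ _ := by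
        rw [← expect_sum_comm]
        refine expect_le_expect fun S _ => ?_
        by_cases h : e ∈ (trim (sampledGraph χ S) D).edgeSet
        · rw [if_neg (not_not.2 h)]
          have h' := (mem_trim_edgeSet.1 h).1
          refine sum_nonpos fun f _ => ?_
          by_cases h1 : f ∈ (sampledGraph χ S).edgeSet <;>
          by_cases h2 : f ∈ (trim (sampledGraph χ S) D).edgeSet <;> simp [h1, h2, h']
        · rw [if_pos h]
          have h3 : ((trim (sampledGraph χ S) D).degree v : ℝ) ≤
              maxDegree (trim (sampledGraph χ S) D) e := by
            exact_mod_cast degree_le_maxDegree _ hv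
          refine le_trans ?_ h3
          rw [degree_eq_card_inter ((trim_le _ D).trans (sampledGraph_le χ S)),
            inter_comm, ← filter_mem_eq_inter, card_filter, Nat.cast_sum]
          refine (sum_le_sum_of_subset_of_nonneg (erase_subset e _)
            fun f _ _ => Nat.cast_nonneg _).trans' ?_
          refine sum_le_sum fun f _ => ?_
          by_cases h1 : f ∈ (sampledGraph χ S).edgeSet <;>
          by_cases h4 : e ∈ (sampledGraph χ S).edgeSet <;>
          by_cases h2 : f ∈ (trim (sampledGraph χ S) D).edgeSet <;> simp [h1, h2, h4]

end Degrees

/-! ### The kernel property -/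

theorem div_le_div_of_degree_bounds {ε c d μ r t b E : ℝ} (hε : 0 < ε) (hε4 : ε < 1 / 4)
    (hc : 0 < c) (hcd : c ≤ ε * d) (hμ : (1 - ε) ^ 2 * (d / c) ≤ μ) (hr : r ≤ 1)
    (ht : 4 * t ≤ ε ^ 2) (hb : ε < b) (hbr : b ≤ 1 - r + 2 * t)
    (hE : (μ - r) * (1 - r - 2 * t) ≤ E) :
    d * (1 + 4 * ε) / (c * (1 + 40 * ε)) ≤ E / b := by
  have hq : 1 ≤ ε * (d / c) := by rw [← mul_div_assoc, one_le_div hc]; exact hcd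
  have hq0 : 0 < d / c := pos_of_mul_pos_right (one_pos.trans_le hq) hε.le
  have hb0 : 0 < b := hε.trans hb
  -- Discarding `e` itself costs `r ≤ 1 ≤ ε d/c`.
  have h1 : d / c * ((1 - ε) ^ 2 - ε) ≤ μ - r := by linarith
  -- The gap `4t` between the two bounds is at most `ε² ≤ εb`.
  have h2 : b * (1 - ε) ≤ 1 - r - 2 * t := by nlinarith
  have h3 : 0 ≤ (1 - ε) ^ 2 - ε := by nlinarith
  have h4 : (1 + 4 * ε) ≤ (((1 - ε) ^ 2 - ε) * (1 - ε)) * (1 + 40 * ε) := by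
    -- The value at `ε = 1/4`. The product is at least `1 - 4ε`, so `40 · 15/64 > 8` suffices for
    -- the constant `40`.
    have h5 : 15 / 64 ≤ ((1 - ε) ^ 2 - ε) * (1 - ε) := by
      have h6 : (5 / 16 : ℝ) ≤ (1 - ε) ^ 2 - ε := by nlinarith
      nlinarith
    nlinarith [pow_pos hε 3]
  calc d * (1 + 4 * ε) / (c * (1 + 40 * ε)) = d / c * ((1 + 4 * ε) / (1 + 40 * ε)) :=
        mul_div_mul_comm _ _ _ _
    _ ≤ d / c * (((1 - ε) ^ 2 - ε) * (1 - ε)) := by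
        refine mul_le_mul_of_nonneg_left ?_ hq0.le
        rwa [div_le_iff₀ (by positivity)]
    _ ≤ E / b := by
        rw [le_div_iff₀ hb0]
        refine le_trans ?_ hE
        calc d / c * (((1 - ε) ^ 2 - ε) * (1 - ε)) * b
            = d / c * ((1 - ε) ^ 2 - ε) * (b * (1 - ε)) := by ring
          _ ≤ (μ - r) * (1 - r - 2 * t) :=
              mul_le_mul h1 h2 (mul_nonneg hb0.le (by linarith))
                ((mul_nonneg hq0.le h3).trans h1)

theorem isKernel_trim_outputDist {V : Type*} [Fintype V] {G : SimpleGraph V} {x : Sym2 V → ℝ}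
    {ε c d : ℝ} {γ : ℕ} (hε : 0 < ε) (hε4 : ε < 1 / 4) (hc : 1 ≤ c)
    (hd : 4 * Real.log (2 / ε) / ε ^ 2 ≤ d) (hγ : 1 ≤ γ) (hcd : c ≤ ε * d)
    (hcn : ε * c ≤ Fintype.card V) (hx : IsApproxMaximal G x c d)
    (hlev : ∀ e ∈ G.edgeSet, 1 / d < x e →
      ∃ i : Level (Fintype.card V) ε, e ∈ (levelGraph G x ε i).edgeSet)
    (χ : LevelColorings G x ε γ) :
    IsKernel G ((outputDist χ d).map fun H => trim H (d * (1 + 4 * ε)))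
      (c * (1 + 40 * ε)) (d * (1 + 4 * ε)) ε := by
  have hc0 : 0 < c := one_pos.trans_le hc
  have hd1 : 1 ≤ ε * d := hc.trans hcd
  have hd0 : 0 < d := pos_of_mul_pos_right (one_pos.trans_le hd1) hε.le
  have ht : 4 * ((1 + ε) * (ε / 2) ^ 4) ≤ ε ^ 2 := by
    have h1 : ε ^ 2 ≤ 1 := by nlinarith
    have h2 : (1 + ε) * ε ^ 2 ≤ 2 * 1 := mul_le_mul (by linarith) h1 (by positivity) two_pos.le
    nlinarith [mul_le_mul_of_nonneg_left h2 (sq_nonneg ε)]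
  rw [outputDist, PMF.map_comp]
  have hsupp : ∀ H ∈ ((PMF.uniformOfFinset (samples (Fintype.card V) γ ε d)
      (samples_nonempty _ γ ε d)).map
        ((fun H => trim H (d * (1 + 4 * ε))) ∘ sampledGraph χ)).support,
      ∃ S, trim (sampledGraph χ S) (d * (1 + 4 * ε)) = H := by
    intro H hH
    obtain ⟨S, -, hS⟩ := (PMF.mem_support_map_iff _ _ _).1 hH
    exact ⟨S, hS⟩
  refine ⟨fun H hH => ?_, fun H hH v => ?_, fun e he hb => ?_⟩
  · obtain ⟨S, rfl⟩ := hsupp H hH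
    exact (trim_le _ _).trans (sampledGraph_le χ S)
  · obtain ⟨S, rfl⟩ := hsupp H hH
    exact degree_trim_le _ (by positivity) v
  · rw [integral_cond_map_uniformOfFinset]
    rw [measureReal_map_uniformOfFinset] at hb ⊢
    simp only [Function.comp_apply, Set.mem_ofPred_eq] at hb ⊢
    have hbr := expect_notMem_trim_le χ hε hε4 hd hγ hd1 hx.toIsFractionalMatching he
    rcases hx.covered e he with hxe | ⟨v, hv, hvc, hvd⟩
    -- Here `r_e = 1`, so the edge is missing with probability at most `2t < ε`.
    · exfalso
      obtain ⟨i, hi⟩ := hlev e he hxe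
      rw [edgeRate_eq_one hε hγ hd0 hi hxe] at hbr
      have := hb.trans_le
        ((expect_congr rfl fun S _ => by congr).trans_le hbr)
      nlinarith
    · exact div_le_div_of_degree_bounds hε hε4 hc0 hcd
        (le_sum_edgeRate hε (by linarith) hγ hd1 hc0 hcn hx.toIsFractionalMatching hvc hvd)
        (edgeRate_le_one hε e) ht hb
        ((expect_congr rfl fun S _ => by congr).trans_le hbr)
        ((le_expect_maxDegree χ hε hε4 hd hγ hd1 hx.toIsFractionalMatching he hv).trans_eq
          (expect_congr rfl fun S _ => by congr))

end EdgeColorSparsify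
end

theorem mainTheorem11 :
    ∃ K : ℝ, 0 < K ∧
      ∀ (V : Type*) [Fintype V] (G : SimpleGraph V) (x : Sym2 V → ℝ) (ε c d : ℝ) (γ : ℕ),
        0 < ε → ε < 1 / 4 → 1 / (1 - ε) ≤ c → 4 * Real.log (2 / ε) / ε ^ 2 ≤ d → 1 ≤ γ →
        c ≤ ε * d → ε * c ≤ Fintype.card V →
        EdgeColorSparsify.IsApproxMaximal G x c d →
        (∀ e ∈ G.edgeSet, 1 / d < x e →
          ∃ i : EdgeColorSparsify.Level (Fintype.card V) ε,
            e ∈ (EdgeColorSparsify.levelGraph G x ε i).edgeSet) →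
        ∀ χ : EdgeColorSparsify.LevelColorings G x ε γ,
          EdgeColorSparsify.IsKernel G
            ((EdgeColorSparsify.outputDist χ d).map
              fun H => EdgeColorSparsify.trim H (d * (1 + 4 * ε)))
            (c * (1 + K * ε)) (d * (1 + 4 * ε)) ε := by
  refine ⟨40, by norm_num, fun V _ G x ε c d γ hε hε4 hc hd hγ hcd hcn hx hlev χ => ?_⟩
  have hc1 : 1 ≤ c := le_trans (by rw [le_div_iff₀ (by linarith)]; linarith) hc
  exact EdgeColorSparsify.isKernel_trim_outputDist hε hε4 hc1 hd hγ hcd hcn hx hlev χ
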